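/- Let $G=(V,E)$ be a finite connected simple graph with at least two vertices that is $D$-regular, and let $L=\operatorname{diam}(G)$. Write $d$ for the graph distance, $[x,y]=\{z\in V: d(x,z)+d(z,y)=d(x,y)\}$ for the interval between $x$ and $y$, $N_x$ for the set of neighbours of $x$, and $N_{xy}=N_x\cap N_y$. Assume that $G$ is *self-centered*: for every $x\in V$ there is $y\in V$ with $d(x,y)=L$. Definitions. * For $p\in[0,1]$ let $\mu_x^p$ be the probability measure with mass $p$ at $x$ and mass $(1-p)/D$ at each neighbour of $x$. Let $W_1$ be the Wasserstein distance with cost $d$, that is, $W_1(\mu,\nu)=\inf_\pi\sum_{u,v}d(u,v)\pi(u,v)$ over all $\pi:V\times V\to[0,1]$ with marginals $\mu$ and $\nu$. Let $\kappa_p(x,y)=1-W_1(\mu_x^p,\mu_y^p)/d(x,y)$ for $x\ne y$, and $\kappa(x,y)=\frac{D+1}{D}\,\kappa_{1/(D+1)}(x,y)$. The graph $G$ is *Bonnet-Myers sharp* if $\inf_{x\sim y}\kappa(x,y)=\frac2L$. * For $m\in\mathbb R$, $G$ *satisfies $\Lambda(m)$* if for every edge $\{x,y\}$ the following holds: the edge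 is contained in at least $m$ triangles, and there is a perfect matching (along edges of $G$) between $N_x\setminus(N_{xy}\cup\{y\})$ and $N_y\setminus(N_{xy}\cup\{x\})$. * A connected graph $H$ is *antipodal* if for every vertex $x$ there is another vertex $\overline x$ such that the interval $[x,\overline x]$ of $H$ is the whole vertex set of $H$. * $G$ is *strongly spherical* if $G$ is antipodal and for all $x\neq y$ in $V$ and all $z\in[x,y]$ there is $\overline z\in[x,y]$ with $[x,y]=[z,\overline z]$ (intervals of $G$). In particular, the induced subgraphs of all intervals $[x,y]$ with $x\ne y$ are then antipodal. Then: 1. If $G$ is Bonnet-Myers sharp, then for any two different vertices $x,y\in V$ the induced subgraph of the interval $[x,y]$ is antipodal, and $G$ is strongly spherical. 2. If $G$ satisfies $\Lambda\left(\frac{2D}{L}-2\right)$, then $G$ is strongly spherical. 3. The hypotheses of 1 and 2 are equivalent: $G$ is Bonnet-Myers sharp if and only if $G$ satisfies $\Lambda\left(\frac{2D}{L}-2\right)$. -/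

import Mathlib

namespace SimpleGraph

section Metric

variable {V : Type*} (G : SimpleGraph V)

/-- The interval `[x, y]` of a connected graph: all vertices lying on geodesics from `x` to `y`. -/
def geodInterval (x y : V) : Set V :=
  {z | G.dist x z + G.dist z y = G.dist x y}

variable {G} in
theorem mem_geodInterval {x y z : V} :
    z ∈ G.geodInterval x y ↔ G.dist x z + G.dist z y = G.dist x y := Iff.rfl

/-- Every vertex is a pole, that is, has a vertex at distance `diam G`. -/
def IsSelfCentered : Prop :=
  ∀ x : V, ∃ y : V, G.dist x y = G.diam

/-- A connected graph is antipodal if every vertex `x` has another vertex `y` with `[x, y] = V`. -/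
def IsAntipodal : Prop :=
  G.Connected ∧ ∀ x : V, ∃ y : V, y ≠ x ∧ G.geodInterval x y = Set.univ

/-- Strongly spherical graphs: `G` is antipodal, and for every interval `[x, y]` with `x ≠ y` and
every `z` in it there is `w` in it such that `[x, y] = [z, w]`, the intervals being taken in `G`.
In particular the induced subgraph of every such interval is antipodal with respect to its own
metric, see `IsStronglySpherical.isAntipodal_induce` below. -/
structure IsStronglySpherical : Prop where
  isAntipodal : G.IsAntipodal
  interval_eq : ∀ x y : V, x ≠ y → ∀ z ∈ G.geodInterval x y,
    ∃ w ∈ G.geodInterval x y, G.geodInterval x y = G.geodInterval z w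

/-- The set `N_x \ (N_xy ∪ {y})`: neighbours of `x` other than `y` that do not lie on a triangle
containing the edge `{x, y}`. -/
def privateNeighbors (x y : V) : Set V :=
  G.neighborSet x \ (G.commonNeighbors x y ∪ {y})

/-- The property `Λ(m)`, for real `m`, at an edge `{x, y}`: the edge lies in at least `m` triangles,
and there is a perfect matching between the neighbours of `x` and the neighbours of `y` that are
not involved in the triangles containing the edge. -/
def SatisfiesLambdaAt (m : ℝ) (x y : V) : Prop :=
  m ≤ ((G.commonNeighbors x y).ncard : ℝ) ∧
    ∃ f : G.privateNeighbors x y ≃ G.privateNeighbors y x, ∀ u : G.privateNeighbors x y, G.Adj u (f u)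

/-- The property `Λ(m)`: it holds at each edge. -/
def SatisfiesLambda (m : ℝ) : Prop :=
  ∀ x y : V, G.Adj x y → G.SatisfiesLambdaAt m x y

variable {G}

/-- In a strongly spherical graph the induced subgraphs of all intervals are antipodal. -/
theorem IsStronglySpherical.isAntipodal_induce (h : G.IsStronglySpherical) {x y : V}
    (hxy : x ≠ y) : (G.induce (G.geodInterval x y)).IsAntipodal := by
  have hc : G.Connected := h.isAntipodal.1
  -- a geodesic between two vertices of `[a, b]` that stays in `[x, y]`
  have key : ∀ s : Set V, ∀ u v : s, G.geodInterval u v ⊆ s →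
      ∃ p : (G.induce s).Walk u v, p.length = G.dist (u : V) v := by
    intro s u v hs
    obtain ⟨p, hp⟩ := hc.exists_walk_length_eq_dist (u : V) v
    have hw : ∀ w ∈ p.support, w ∈ s := by
      intro w hw
      apply hs
      classical
      have h1 := G.dist_le (p.takeUntil w hw)
      have h2 := G.dist_le (p.dropUntil w hw)
      have h3 := congrArg Walk.length (p.take_spec hw)
      rw [Walk.length_append] at h3
      have h4 := hc.dist_triangle (u := (u : V)) (v := w) (w := v)
      simp only [mem_geodInterval]
      omega
    refine ⟨p.induce s hw, ?_⟩
    rw [← hp, ← Walk.length_map (Embedding.induce (G := G) s).toHom, Walk.map_induce]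
    rfl
  have sub : ∀ a b w : V, w ∈ G.geodInterval a b →
      G.geodInterval a w ⊆ G.geodInterval a b ∧ G.geodInterval w b ⊆ G.geodInterval a b := by
    intro a b w hw
    simp only [mem_geodInterval] at hw
    constructor
    · intro t ht
      simp only [mem_geodInterval] at ht ⊢
      have h1 := hc.dist_triangle (u := t) (v := w) (w := b)
      have h2 := hc.dist_triangle (u := a) (v := t) (w := b)
      omega
    · intro t ht
      simp only [mem_geodInterval] at ht ⊢
      have h1 := hc.dist_triangle (u := a) (v := w) (w := t)
      have h2 := hc.dist_triangle (u := a) (v := t) (w := b)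
      omega
  have hx : x ∈ G.geodInterval x y := by simp [mem_geodInterval]
  have hy : y ∈ G.geodInterval x y := by simp [mem_geodInterval]
  have hcs : (G.induce (G.geodInterval x y)).Connected := by
    have : Nonempty (G.geodInterval x y) := ⟨⟨x, hx⟩⟩
    refine ⟨fun u v => ?_⟩
    obtain ⟨p, -⟩ := key _ ⟨x, hx⟩ u (sub x y u u.2).1
    obtain ⟨q, -⟩ := key _ ⟨x, hx⟩ v (sub x y v v.2).1
    exact ⟨p.reverse.append q⟩
  have hdist : ∀ u v : G.geodInterval x y, G.geodInterval u v ⊆ G.geodInterval x y →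
      (G.induce (G.geodInterval x y)).dist u v = G.dist (u : V) v := by
    intro u v huv
    obtain ⟨p, hp⟩ := key _ u v huv
    apply le_antisymm
    · rw [← hp]; exact dist_le p
    · obtain ⟨q, hq⟩ := hcs.exists_walk_length_eq_dist u v
      rw [← hq, ← Walk.length_map (Embedding.induce (G := G) _).toHom]
      exact dist_le _
  refine ⟨hcs, fun z => ?_⟩
  obtain ⟨w, hw, he⟩ := h.interval_eq x y hxy z z.2
  have hzw : w ≠ z := by
    intro hwz
    have hsing : ∀ t ∈ G.geodInterval x y, t = z := by
      intro t ht
      rw [he, hwz] at ht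
      simp only [mem_geodInterval, dist_self] at ht
      exact ((hc.dist_eq_zero_iff (u := (z : V)) (v := t)).1 (by omega)).symm
    exact hxy ((hsing x hx).trans (hsing y hy).symm)
  refine ⟨⟨w, hw⟩, fun hh => hzw (congrArg Subtype.val hh), ?_⟩
  ext t
  have ht : (t : V) ∈ G.geodInterval z w := he ▸ t.2
  have h1 := hdist z t ((sub z w t ht).1.trans he.ge)
  have h2 := hdist t ⟨w, hw⟩ ((sub z w t ht).2.trans he.ge)
  have h3 := hdist z ⟨w, hw⟩ he.ge
  simp only [mem_geodInterval] at ht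
  simp only [mem_geodInterval, Set.mem_univ, iff_true]
  rw [h1, h2, h3]
  exact ht

end Metric

section Curvature

variable {V : Type*} [Fintype V] (G : SimpleGraph V)

/-- Transport plans between two probability measures on `V`, given by their mass functions. -/
def transportPlans (μ ν : V → ℝ) : Set (V → V → ℝ) :=
  {π | (∀ x y, π x y ∈ Set.Icc (0 : ℝ) 1) ∧ (∀ x, μ x = ∑ y, π x y) ∧ (∀ y, ν y = ∑ x, π x y)}

/-- The cost of a transport plan with respect to the graph distance. -/
noncomputable def transportCost (π : V → V → ℝ) : ℝ :=
  ∑ x, ∑ y, (G.dist x y : ℝ) * π x y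

/-- The Wasserstein distance `W₁` between two probability measures on `V`. -/
noncomputable def wassersteinDist (μ ν : V → ℝ) : ℝ :=
  sInf (G.transportCost '' transportPlans μ ν)

variable [DecidableEq V] [DecidableRel G.Adj]

/-- The measure `μ_x^p`: mass `p` at `x` and mass `(1 - p) / d_x` at every neighbour of `x`. -/
noncomputable def lazyMeasure (p : ℝ) (x : V) : V → ℝ := fun z =>
  if z = x then p else if G.Adj x z then (1 - p) / (G.degree x : ℝ) else 0

/-- The Ollivier Ricci curvature `κ_p(x, y)` with idleness `p` (for `x ≠ y`). -/
noncomputable def idleCurvature (p : ℝ) (x y : V) : ℝ :=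
  1 - G.wassersteinDist (G.lazyMeasure p x) (G.lazyMeasure p y) / (G.dist x y : ℝ)

/-- The curvature `κ(x, y) = (D + 1) / D * κ_{1 / (D + 1)}(x, y)` of a `D`-regular graph. -/
noncomputable def ollivierCurvature (D : ℕ) (x y : V) : ℝ :=
  ((D : ℝ) + 1) / (D : ℝ) * G.idleCurvature (1 / ((D : ℝ) + 1)) x y

/-- `(D, L)`-Bonnet-Myers sharp graphs, `L = diam G`: connected `D`-regular graphs for which
`inf_{x ∼ y} κ(x, y)` is positive and equal to `2 / L`. -/
structure IsBonnetMyersSharp (D : ℕ) : Prop where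
  connected : G.Connected
  regular : G.IsRegularOfDegree D
  pos : 0 < 2 / (G.diam : ℝ)
  isGLB : IsGLB {k : ℝ | ∃ x y : V, G.Adj x y ∧ k = G.ollivierCurvature D x y}
    (2 / (G.diam : ℝ))

end Curvature

end SimpleGraph

namespace SimpleGraph

/-! ### Neighbourhoods along an edge and the Laplacian of distance functions. -/

section Laplacian

variable {V : Type*} {G : SimpleGraph V}

/-! Put `c = 2D/L`. The link between curvature, matchings and intervals is the identity
`DistLaplacianEq D c` for all distance functions.

Sharpness gives it. By Kantorovich duality a bound `κ ≥ k` on edges makes the neighbour sum of `d(w,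
·)` grow by at most `D - Dk` per geodesic step (`sum_dist_le`). For poles `x`, `y` and `k = 2/L`,
adding the bounds based at `x` and `y` meets the triangle inequality with equality, so `[x, y] = V`
and the bounds are identities (`rigidity_of_poles`). Self-centeredness makes every vertex such a
base point.

Given the identity, `d(x, ·)` is an optimal potential on an edge `{x, y}`; complementary slackness
makes an optimal plan move private neighbours along edges, and Hall's theorem extracts a matching.
Conversely, a matching is a cheap plan, which bounds curvature below by `2/L`, and Bonnet-Myers
shows that no larger bound holds.

Strong sphericity uses the identity and the matchings together: subtracting the identity at the two
ends of an edge shows that matched edges are parallel, meaning that every vertex sees the same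
change of distance along both. Completing parallelograms along geodesics then yields `w` with `d(·,
z) + d(·, w) = d(·, x) + d(·, y)` for each `z ∈ [x, y]`, whence `[z, w] = [x, y]`. -/

theorem mem_privateNeighbors {x y a : V} :
    a ∈ G.privateNeighbors x y ↔ G.Adj x a ∧ ¬ G.Adj y a ∧ a ≠ y := by
  simp only [privateNeighbors, Set.mem_sdiff, mem_neighborSet, Set.mem_union, mem_commonNeighbors,
    Set.mem_singleton_iff]
  tauto

theorem Connected.dist_le_dist_add_one (hc : G.Connected) {a b : V} (h : G.Adj a b) (w : V) :
    G.dist w b ≤ G.dist w a + 1 := by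
  have h1 := hc.dist_triangle (u := w) (v := a) (w := b)
  rw [dist_eq_one_iff_adj.2 h] at h1
  exact h1

theorem Connected.exists_adj_dist_add_one (hc : G.Connected) {x y : V} (h : x ≠ y) :
    ∃ z, G.Adj x z ∧ G.dist x y = G.dist z y + 1 := by
  obtain ⟨p, hp⟩ := hc.exists_walk_length_eq_dist x y
  cases p with
  | nil => exact absurd rfl h
  | cons hadj q =>
    refine ⟨_, hadj, ?_⟩
    have h1 := dist_le q
    have h2 := hc.dist_le_dist_add_one hadj.symm y
    rw [dist_comm, dist_comm (u := y)] at h2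
    rw [Walk.length_cons] at hp
    omega

theorem Connected.dist_eq_two_of_mem_privateNeighbors (hc : G.Connected) {x z a : V}
    (h : G.Adj x z) (ha : a ∈ G.privateNeighbors x z) : G.dist a z = 2 := by
  rw [mem_privateNeighbors] at ha
  have h1 := hc.dist_le_dist_add_one h a
  rw [dist_eq_one_iff_adj.2 ha.1.symm] at h1
  have h2 := hc.one_lt_dist_of_ne_of_not_adj ha.2.2 (fun h => ha.2.1 h.symm)
  omega

variable [Fintype V]

noncomputable instance fintypePrivateNeighbors (x y : V) : Fintype (G.privateNeighbors x y) :=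
  Fintype.ofFinite _

variable [DecidableEq V] [DecidableRel G.Adj]

/-- The neighbours of `x` are sorted along an edge `{x, z}`. -/
theorem sum_neighborFinset_eq {x z : V} (h : G.Adj x z) (f : V → ℝ) :
    ∑ u ∈ G.neighborFinset x, f u =
      f z + ∑ u ∈ G.neighborFinset x ∩ G.neighborFinset z, f u +
        ∑ a : G.privateNeighbors x z, f a := by
  have h1 : ∑ a : G.privateNeighbors x z, f a =
      ∑ a ∈ (G.neighborFinset x \ G.neighborFinset z).erase z, f a := by
    refine (Finset.sum_subtype _ (fun a => ?_) f).symm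
    simp only [Finset.mem_erase, Finset.mem_sdiff, mem_neighborFinset, mem_privateNeighbors]
    tauto
  have hz : z ∈ G.neighborFinset x \ G.neighborFinset z := by simp [h]
  rw [h1, ← Finset.sum_inter_add_sum_sdiff (G.neighborFinset x) (G.neighborFinset z),
    ← Finset.add_sum_erase _ f hz]
  ring

theorem ncard_commonNeighbors (x z : V) :
    (G.commonNeighbors x z).ncard = (G.neighborFinset x ∩ G.neighborFinset z).card := by
  rw [← Set.ncard_coe_finset]
  congr 1
  ext; simp [mem_commonNeighbors]

theorem card_privateNeighbors {D : ℕ} (hreg : G.IsRegularOfDegree D) {x z : V} (h : G.Adj x z) :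
    (D : ℝ) = 1 + (G.commonNeighbors x z).ncard + Fintype.card (G.privateNeighbors x z) := by
  have := sum_neighborFinset_eq h (fun _ => (1 : ℝ))
  simp only [Finset.sum_const, nsmul_eq_mul, mul_one, card_neighborFinset_eq_degree, hreg x,
    Finset.card_univ] at this
  rw [this, ncard_commonNeighbors]

variable (G) in
/-- Every distance function, shifted by a constant, is an eigenfunction of the Laplacian: the
neighbours of `v` have average distance `d(w, v) + 1 - (c / D) d(w, v)` from `w`. -/
def DistLaplacianEq (D : ℕ) (c : ℝ) : Prop :=
  ∀ w v : V, ∑ u ∈ G.neighborFinset v, (G.dist w u : ℝ) = D * G.dist w v + D - c * G.dist w v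

/-! ### Parallel edges and opposite vertices. -/

section Matching

variable {D : ℕ} {c : ℝ}

/-- A perfect matching along an edge moves away from every vertex from which the edge points
away. -/
theorem dist_matching_eq (hc : G.Connected) (hreg : G.IsRegularOfDegree D)
    (hE : G.DistLaplacianEq D c) {x z : V} (hxz : G.Adj x z)
    (hm : c - 2 ≤ ((G.commonNeighbors x z).ncard : ℝ))
    (φ : G.privateNeighbors x z ≃ G.privateNeighbors z x) (hφ : ∀ a : G.privateNeighbors x z, G.Adj a (φ a))
    {w : V} (hw : G.dist w z = G.dist w x + 1) (a : G.privateNeighbors x z) :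
    G.dist w (φ a) = G.dist w a + 1 := by
  have e1 := sum_neighborFinset_eq hxz (fun u => (G.dist w u : ℝ))
  have e2 := sum_neighborFinset_eq hxz.symm (fun u => (G.dist w u : ℝ))
  rw [hE] at e1 e2
  rw [Finset.inter_comm, ← Equiv.sum_comp φ] at e2
  have e3 := card_privateNeighbors hreg hxz
  have hw' : (G.dist w z : ℝ) = G.dist w x + 1 := by exact_mod_cast hw
  have hle : ∀ a : G.privateNeighbors x z, 0 ≤ (G.dist w a : ℝ) + 1 - G.dist w (φ a) := by
    intro a
    have := hc.dist_le_dist_add_one (hφ a) w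
    have : (G.dist w (φ a) : ℝ) ≤ G.dist w a + 1 := by exact_mod_cast this
    linarith
  -- Subtracting `e1` from `e2` cancels the common neighbours. With `T` triangles on the edge the
  -- sum equals `c - 2 - T`, which is where the triangle bound enters.
  have hsum : ∑ a : G.privateNeighbors x z, ((G.dist w a : ℝ) + 1 - G.dist w (φ a)) ≤ 0 := by
    rw [Finset.sum_sub_distrib, Finset.sum_add_distrib]
    simp only [Finset.sum_const, nsmul_eq_mul, mul_one, Finset.card_univ]
    rw [hw'] at e1 e2
    linarith
  have h0 := (Finset.sum_eq_zero_iff_of_nonneg (fun a _ => hle a)).1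
    (le_antisymm hsum (Finset.sum_nonneg fun a _ => hle a)) a (Finset.mem_univ a)
  have : (G.dist w (φ a) : ℝ) = G.dist w a + 1 := by linarith
  exact_mod_cast this

theorem dist_matching_eq_symm (hc : G.Connected) (hreg : G.IsRegularOfDegree D)
    (hE : G.DistLaplacianEq D c) {x z : V} (hxz : G.Adj x z)
    (hm : c - 2 ≤ ((G.commonNeighbors x z).ncard : ℝ))
    (φ : G.privateNeighbors x z ≃ G.privateNeighbors z x) (hφ : ∀ a : G.privateNeighbors x z, G.Adj a (φ a))
    {w : V} (hw : G.dist w x = G.dist w z + 1) (a : G.privateNeighbors x z) :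
    G.dist w a = G.dist w (φ a) + 1 := by
  have := dist_matching_eq hc hreg hE hxz.symm (by rwa [commonNeighbors_symm]) φ.symm
    (fun b : G.privateNeighbors z x => by simpa using (hφ (φ.symm b)).symm) hw (φ a)
  simpa using this

/-- A vertex adjacent to `b` and to `x` that is far from `a` is the partner of `b`. -/
theorem eq_matching_of_adj (hc : G.Connected) (hreg : G.IsRegularOfDegree D)
    (hE : G.DistLaplacianEq D c) {a x : V} (hax : G.Adj a x)
    (hm : c - 2 ≤ ((G.commonNeighbors a x).ncard : ℝ))
    (ψ : G.privateNeighbors a x ≃ G.privateNeighbors x a)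
    (hψ : ∀ b : G.privateNeighbors a x, G.Adj b (ψ b))
    (b : G.privateNeighbors a x) (v : G.privateNeighbors x a) (hbv : G.Adj (b : V) v) :
    v = ψ b := by
  have h2 := hc.dist_eq_two_of_mem_privateNeighbors hax b.2
  have h1 : G.dist (b : V) a = 1 := dist_eq_one_iff_adj.2 (mem_privateNeighbors.1 b.2).1.symm
  -- Seen from `b`, the edge from `a` to `x` points away, so the partner `b'` of `v` satisfies `1 =
  -- d(b, v) = d(b, b') + 1`.
  have h3 := dist_matching_eq hc hreg hE hax hm ψ hψ (w := b) (by omega) (ψ.symm v)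
  rw [Equiv.apply_symm_apply, dist_eq_one_iff_adj.2 hbv] at h3
  have h4 := (hc.dist_eq_zero_iff (u := (b : V)) (v := (ψ.symm v : V))).1 (by omega)
  rw [← Equiv.symm_apply_eq]
  exact Subtype.ext h4.symm

/-- Matched edges are parallel: the differences of the distance functions to their ends agree. -/
theorem dist_sub_dist_matching (hc : G.Connected) (hreg : G.IsRegularOfDegree D)
    (hE : G.DistLaplacianEq D c) (hΛ : G.SatisfiesLambda (c - 2)) {x z : V} (hxz : G.Adj x z)
    (φ : G.privateNeighbors x z ≃ G.privateNeighbors z x)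
    (hφ : ∀ a : G.privateNeighbors x z, G.Adj a (φ a)) (a : G.privateNeighbors x z) (w : V) :
    (G.dist w x : ℤ) - G.dist w z = G.dist w a - G.dist w (φ a) := by
  have hm := (hΛ x z hxz).1
  obtain ⟨hxa, hza, haz⟩ := mem_privateNeighbors.1 a.2
  obtain ⟨hzb, hxb, hbx⟩ := mem_privateNeighbors.1 (φ a).2
  have hab := hφ a
  obtain ⟨hm', φ', hφ'⟩ := hΛ a (φ a) hab
  obtain ⟨hm'', ψ, hψ⟩ := hΛ a x hxa.symm
  have hx : x ∈ G.privateNeighbors (a : V) (φ a) :=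
    mem_privateNeighbors.2 ⟨hxa.symm, fun h => hxb h.symm, hbx.symm⟩
  have hb : (φ a : V) ∈ G.privateNeighbors (a : V) x := mem_privateNeighbors.2 ⟨hab, hxb, hbx⟩
  have hz : z ∈ G.privateNeighbors x (a : V) :=
    mem_privateNeighbors.2 ⟨hxz, fun h => hza h.symm, haz.symm⟩
  obtain ⟨hbz', haz', hza'⟩ := mem_privateNeighbors.1 (φ' ⟨x, hx⟩).2
  have hz' : (φ' ⟨x, hx⟩ : V) ∈ G.privateNeighbors x (a : V) :=
    mem_privateNeighbors.2 ⟨hφ' ⟨x, hx⟩, haz', hza'⟩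
  have e1 := eq_matching_of_adj hc hreg hE hxa.symm hm'' ψ hψ ⟨_, hb⟩ ⟨z, hz⟩ hzb.symm
  have e2 := eq_matching_of_adj hc hreg hE hxa.symm hm'' ψ hψ ⟨_, hb⟩ ⟨_, hz'⟩ hbz'
  -- In the square `x, z, φ a, a`, both `z` and `φ' x` are the partner of `φ a` across the edge `{a,
  -- x}`. So the matching of `{a, φ a}` recovers the edge `{x, z}`, and the implications below run
  -- in both directions.
  have e3 : (φ' ⟨x, hx⟩ : V) = z := congrArg Subtype.val (e2.trans e1.symm)
  have k1 := fun h => dist_matching_eq hc hreg hE hxz hm φ hφ (w := w) h a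
  have k2 := fun h => dist_matching_eq_symm hc hreg hE hxz hm φ hφ (w := w) h a
  have k3 := fun h => dist_matching_eq hc hreg hE hab hm' φ' hφ' (w := w) h ⟨x, hx⟩
  have k4 := fun h => dist_matching_eq_symm hc hreg hE hab hm' φ' hφ' (w := w) h ⟨x, hx⟩
  rw [e3] at k3 k4
  have l1 := hc.dist_le_dist_add_one hxz w
  have l2 := hc.dist_le_dist_add_one hxz.symm w
  have l3 := hc.dist_le_dist_add_one hab w
  have l4 := hc.dist_le_dist_add_one hab.symm w
  simp only at k3 k4
  -- Both differences lie in `{-1, 0, 1}`. A value `±1` of either forces the same value of the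
  -- other, so the zero case agrees too.
  omega

/-- Opposite vertices for an interval and one of its vertices adjacent to an end. -/
theorem exists_opposite_of_adj (hc : G.Connected) (hreg : G.IsRegularOfDegree D)
    (hE : G.DistLaplacianEq D c) (hΛ : G.SatisfiesLambda (c - 2)) {x z : V} (hxz : G.Adj x z)
    (n : ℕ) (y : V) (hn : G.dist z y = n) (hz : z ∈ G.geodInterval x y) :
    ∃ w, ∀ u, G.dist u z + G.dist u w = G.dist u x + G.dist u y := by
  induction n generalizing y with
  | zero =>
    obtain rfl := hc.dist_eq_zero_iff.1 hn
    exact ⟨x, fun u => add_comm _ _⟩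
  | succ n ih =>
    obtain ⟨y', hy', hd⟩ := hc.exists_adj_dist_add_one (x := y) (y := z) (by
      rintro rfl; simp at hn)
    rw [mem_geodInterval, dist_eq_one_iff_adj.2 hxz] at hz
    have h1 := hc.dist_le_dist_add_one hxz y'
    have h2 := hc.dist_le_dist_add_one hxz.symm y'
    have h3 := hc.dist_le_dist_add_one hy' x
    have h4 := hc.dist_le_dist_add_one hy'.symm x
    rw [dist_comm (u := y), dist_comm (u := y')] at hd
    rw [dist_comm (u := y'), dist_comm (u := y')] at h1 h2
    obtain ⟨w', hw'⟩ := ih y' (by omega) (by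
      rw [mem_geodInterval, dist_eq_one_iff_adj.2 hxz]; omega)
    have e1 := hw' y'
    have e2 := hw' y
    rw [dist_self, dist_comm (u := y'), dist_comm (u := y') (v := x)] at e1
    rw [dist_comm (u := y), dist_comm (u := y) (v := x), dist_eq_one_iff_adj.2 hy'] at e2
    have hw1 : G.Adj y' w' := dist_eq_one_iff_adj.1 (by omega)
    have hw2 : G.dist y w' = 2 := by omega
    have hp : w' ∈ G.privateNeighbors y' y := mem_privateNeighbors.2
      ⟨hw1, fun h => by rw [dist_eq_one_iff_adj.2 h] at hw2; omega,
        fun h => by rw [h, dist_self] at hw2; omega⟩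
    obtain ⟨-, φ, hφ⟩ := hΛ y' y hy'.symm
    -- The opposite vertex `w'` for `[x, y']` is carried across the edge from `y'` to `y`;
    -- parallelism adds the same difference to both sides of the identity for `w'`.
    refine ⟨φ ⟨w', hp⟩, fun u => ?_⟩
    have k1 := dist_sub_dist_matching hc hreg hE hΛ hy'.symm φ hφ ⟨w', hp⟩ u
    have k2 := hw' u
    simp only at k1
    omega

/-- Opposite vertices for an interval and one of its vertices. -/
theorem exists_opposite (hc : G.Connected) (hreg : G.IsRegularOfDegree D)
    (hE : G.DistLaplacianEq D c) (hΛ : G.SatisfiesLambda (c - 2))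
    (n : ℕ) (x y z : V) (hn : G.dist x z = n) (hz : z ∈ G.geodInterval x y) :
    ∃ w, ∀ u, G.dist u z + G.dist u w = G.dist u x + G.dist u y := by
  induction n generalizing x y with
  | zero =>
    obtain rfl := hc.dist_eq_zero_iff.1 hn
    exact ⟨y, fun u => rfl⟩
  | succ n ih =>
    obtain ⟨z', hz', hd⟩ := hc.exists_adj_dist_add_one (x := x) (y := z) (by
      rintro rfl; simp at hn)
    rw [mem_geodInterval] at hz
    have h1 := hc.dist_triangle (u := z') (v := z) (w := y)
    have h2 := hc.dist_triangle (u := x) (v := z') (w := y)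
    have h3 := dist_eq_one_iff_adj.2 hz'
    obtain ⟨w', hw'⟩ := exists_opposite_of_adj hc hreg hE hΛ hz' _ y rfl (by
      rw [mem_geodInterval]; omega)
    have e1 := hw' z
    have e2 := hw' z'
    rw [dist_comm (u := z), dist_comm (u := z), dist_comm (u := z) (v := x)] at e1
    rw [dist_self, dist_comm (v := x)] at e2
    -- The pair `z', w'` has the same distance sum as `x, y` at every vertex, so it can replace `x,
    -- y`, with `z` one step closer to the first end.
    obtain ⟨w, hw⟩ := ih z' w' (by omega) (by
      rw [mem_geodInterval, dist_comm (u := z)]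
      omega)
    exact ⟨w, fun u => (hw u).trans (hw' u)⟩

/-- Evaluating the identity of `exists_opposite` at `z` gives `d(z, w) = d(x, y)`; the two intervals
are then cut out by the same equation. -/
theorem isStronglySpherical_of_satisfiesLambda (hG : G.IsAntipodal) (hreg : G.IsRegularOfDegree D)
    (hE : G.DistLaplacianEq D c) (hΛ : G.SatisfiesLambda (c - 2)) : G.IsStronglySpherical := by
  refine ⟨hG, fun x y _ z hz => ?_⟩
  obtain ⟨w, hw⟩ := exists_opposite hG.1 hreg hE hΛ _ x y z rfl hz
  rw [mem_geodInterval] at hz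
  have e1 := hw z
  have e2 := hw w
  rw [dist_self, dist_comm (u := z) (v := x)] at e1
  rw [dist_self, dist_comm (u := w) (v := x), dist_comm (u := w) (v := z)] at e2
  refine ⟨w, by rw [mem_geodInterval, dist_comm (u := w)]; rw [dist_comm (v := y)] at e2; omega, ?_⟩
  ext u
  have e3 := hw u
  rw [dist_comm (v := z), dist_comm (v := x)] at e3
  rw [mem_geodInterval, mem_geodInterval]
  omega

end Matching

end Laplacian

/-! ### Optimal transport: duality gap and existence of optimal plans. -/

section Transport

variable {V : Type*} [Fintype V] {G : SimpleGraph V}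

/-- The duality gap written as total slack. For 1-Lipschitz `f` every term is nonnegative, giving
weak duality; if the gap vanishes, `π` lives on pairs where `f` rises by the full distance. -/
theorem transportCost_sub_sum_mul_sub_sum_mul {μ ν : V → ℝ} {π : V → V → ℝ}
    (hπ : π ∈ transportPlans μ ν) (f : V → ℝ) :
    G.transportCost π - (∑ v, f v * ν v - ∑ u, f u * μ u) =
      ∑ u, ∑ v, ((G.dist u v : ℝ) - (f v - f u)) * π u v := by
  obtain ⟨-, h1, h2⟩ := hπ
  have e1 : ∑ u, f u * μ u = ∑ u, ∑ v, f u * π u v := by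
    simp_rw [h1, Finset.mul_sum]
  have e2 : ∑ v, f v * ν v = ∑ u, ∑ v, f v * π u v := by
    simp_rw [h2, Finset.mul_sum]
    exact Finset.sum_comm
  rw [e1, e2, transportCost, ← Finset.sum_sub_distrib, ← Finset.sum_sub_distrib]
  refine Finset.sum_congr rfl fun u _ => ?_
  rw [← Finset.sum_sub_distrib, ← Finset.sum_sub_distrib]
  exact Finset.sum_congr rfl fun v _ => by ring

theorem transportCost_nonneg {μ ν : V → ℝ} {π : V → V → ℝ} (hπ : π ∈ transportPlans μ ν) :
    0 ≤ G.transportCost π :=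
  Finset.sum_nonneg fun u _ => Finset.sum_nonneg fun v _ =>
    mul_nonneg (Nat.cast_nonneg _) (hπ.1 u v).1

theorem wassersteinDist_le {μ ν : V → ℝ} {π : V → V → ℝ} (hπ : π ∈ transportPlans μ ν) :
    G.wassersteinDist μ ν ≤ G.transportCost π :=
  csInf_le ⟨0, by rintro _ ⟨ρ, hρ, rfl⟩; exact transportCost_nonneg hρ⟩ ⟨π, hπ, rfl⟩

/-- Compactness makes the infimum attained; complementary slackness needs an actual optimal plan. -/
theorem isCompact_transportPlans (μ ν : V → ℝ) : IsCompact (transportPlans μ ν) := by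
  have hK : IsCompact (Set.pi Set.univ fun _ : V => Set.pi Set.univ fun _ : V =>
      Set.Icc (0 : ℝ) 1) :=
    isCompact_univ_pi fun _ => isCompact_univ_pi fun _ => isCompact_Icc
  refine hK.of_isClosed_subset ?_ fun π hπ u _ v _ => hπ.1 u v
  simp only [transportPlans, Set.ofPred_and, Set.ofPred_forall]
  refine IsClosed.inter ?_ (IsClosed.inter ?_ ?_)
  · exact isClosed_iInter fun u => isClosed_iInter fun v =>
      isClosed_Icc.preimage (by fun_prop : Continuous fun π : V → V → ℝ => π u v)
  · exact isClosed_iInter fun u => isClosed_eq (by fun_prop) (by fun_prop)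
  · exact isClosed_iInter fun u => isClosed_eq (by fun_prop) (by fun_prop)

theorem transportPlans_nonempty {μ ν : V → ℝ} (hμ : ∀ u, 0 ≤ μ u) (hν : ∀ u, 0 ≤ ν u)
    (hμ1 : ∑ u, μ u = 1) (hν1 : ∑ u, ν u = 1) : (transportPlans μ ν).Nonempty := by
  refine ⟨fun u v => μ u * ν v, fun u v => ⟨mul_nonneg (hμ u) (hν v), ?_⟩, fun u => ?_, fun v => ?_⟩
  · exact mul_le_one₀ (hμ1 ▸ Finset.single_le_sum (fun u _ => hμ u) (Finset.mem_univ u)) (hν v)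
      (hν1 ▸ Finset.single_le_sum (fun u _ => hν u) (Finset.mem_univ v))
  · rw [← Finset.mul_sum, hν1, mul_one]
  · rw [← Finset.sum_mul, hμ1, one_mul]

theorem exists_transportCost_eq_wassersteinDist {μ ν : V → ℝ} (h : (transportPlans μ ν).Nonempty) :
    ∃ π ∈ transportPlans μ ν, G.transportCost π = G.wassersteinDist μ ν := by
  refine ((isCompact_transportPlans μ ν).image ?_).sInf_mem (h.image _)
  unfold transportCost
  fun_prop

end Transport

/-! ### Curvature bounds: Laplacian comparison, Bonnet-Myers and its rigidity. -/

section Measure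

variable {V : Type*} [Fintype V] [DecidableEq V] {G : SimpleGraph V} [DecidableRel G.Adj] {D : ℕ}

/-- The idleness `1 / (D + 1)` is the one for which the measure is uniform on the closed unit ball.
-/
theorem lazyMeasure_eq (hreg : G.IsRegularOfDegree D) (hD : 0 < D) (x z : V) :
    G.lazyMeasure (1 / ((D : ℝ) + 1)) x z =
      if z ∈ insert x (G.neighborFinset x) then 1 / ((D : ℝ) + 1) else 0 := by
  have hD' : (D : ℝ) ≠ 0 := by positivity
  have : (1 - 1 / ((D : ℝ) + 1)) / D = 1 / ((D : ℝ) + 1) := by field_simp; ring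
  simp only [lazyMeasure, hreg x, this, Finset.mem_insert, mem_neighborFinset]
  split_ifs <;> tauto

theorem sum_mul_lazyMeasure (hreg : G.IsRegularOfDegree D) (hD : 0 < D) (f : V → ℝ) (x : V) :
    ∑ z, f z * G.lazyMeasure (1 / ((D : ℝ) + 1)) x z =
      (f x + ∑ u ∈ G.neighborFinset x, f u) / (D + 1) := by
  simp only [lazyMeasure_eq hreg hD, mul_ite, mul_zero, Finset.sum_ite_mem, Finset.univ_inter]
  rw [Finset.sum_insert (by simp), ← Finset.sum_mul]
  ring

theorem transportPlans_lazyMeasure_nonempty (hreg : G.IsRegularOfDegree D) (hD : 0 < D) (x y : V) :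
    (transportPlans (G.lazyMeasure (1 / ((D : ℝ) + 1)) x)
      (G.lazyMeasure (1 / ((D : ℝ) + 1)) y)).Nonempty := by
  have h0 : ∀ x u, 0 ≤ G.lazyMeasure (1 / ((D : ℝ) + 1)) x u := by
    intro x u
    rw [lazyMeasure_eq hreg hD]
    split_ifs <;> positivity
  have h1 : ∀ x, ∑ u, G.lazyMeasure (1 / ((D : ℝ) + 1)) x u = 1 := by
    intro x
    have := sum_mul_lazyMeasure hreg hD (fun _ => 1) x
    simp only [one_mul, Finset.sum_const, nsmul_eq_mul, mul_one, card_neighborFinset_eq_degree,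
      hreg x] at this
    rw [this, add_comm, div_self (by positivity)]
  exact transportPlans_nonempty (h0 x) (h0 y) (h1 x) (h1 y)

theorem ollivierCurvature_eq_of_adj (D : ℕ) {x y : V} (h : G.Adj x y) :
    G.ollivierCurvature D x y = ((D : ℝ) + 1) / D *
      (1 - G.wassersteinDist (G.lazyMeasure (1 / ((D : ℝ) + 1)) x)
        (G.lazyMeasure (1 / ((D : ℝ) + 1)) y)) := by
  rw [ollivierCurvature, idleCurvature, dist_eq_one_iff_adj.2 h, Nat.cast_one, div_one]

theorem le_ollivierCurvature_iff (hD : 0 < D) {x y : V} (h : G.Adj x y) (k : ℝ) :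
    k ≤ G.ollivierCurvature D x y ↔
      (D + 1) * G.wassersteinDist (G.lazyMeasure (1 / ((D : ℝ) + 1)) x)
        (G.lazyMeasure (1 / ((D : ℝ) + 1)) y) ≤ D + 1 - D * k := by
  have hD' : (0 : ℝ) < D := by positivity
  rw [ollivierCurvature_eq_of_adj D h, div_mul_eq_mul_div, le_div_iff₀ hD']
  constructor <;> intro h <;> linarith

/-- A lower curvature bound controls the Laplacian of a distance function along an edge. -/
theorem sum_dist_le_of_le_ollivierCurvature (hc : G.Connected) (hreg : G.IsRegularOfDegree D)
    (hD : 0 < D) {k : ℝ} {x y w : V} (h : G.Adj x y) (hk : k ≤ G.ollivierCurvature D x y)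
    (hw : G.dist w y = G.dist w x + 1) :
    ∑ u ∈ G.neighborFinset y, (G.dist w u : ℝ) ≤
      ∑ u ∈ G.neighborFinset x, (G.dist w u : ℝ) + D - D * k := by
  rw [le_ollivierCurvature_iff hD h] at hk
  obtain ⟨π, hπ, hcost⟩ := exists_transportCost_eq_wassersteinDist (G := G)
    (transportPlans_lazyMeasure_nonempty hreg hD x y)
  have h1 := transportCost_sub_sum_mul_sub_sum_mul (G := G) hπ (fun u => (G.dist w u : ℝ))
  have h2 : 0 ≤ ∑ u, ∑ v, ((G.dist u v : ℝ) - (G.dist w v - G.dist w u)) * π u v := by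
    refine Finset.sum_nonneg fun u _ => Finset.sum_nonneg fun v _ => mul_nonneg ?_ (hπ.1 u v).1
    have := hc.dist_triangle (u := w) (v := u) (w := v)
    have : (G.dist w v : ℝ) ≤ G.dist w u + G.dist u v := by exact_mod_cast this
    linarith
  rw [← h1, hcost, sum_mul_lazyMeasure hreg hD, sum_mul_lazyMeasure hreg hD, ← sub_div, sub_nonneg,
    div_le_iff₀ (by positivity), hw] at h2
  push_cast at h2
  linarith

/-- Laplacian comparison: the edge estimate telescopes along a geodesic from `w`, where the
neighbour sum is `D`. -/
theorem sum_dist_le (hc : G.Connected) (hreg : G.IsRegularOfDegree D)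
    (hD : 0 < D) {k : ℝ} (hk : ∀ x y, G.Adj x y → k ≤ G.ollivierCurvature D x y) (w y : V) :
    ∑ u ∈ G.neighborFinset y, (G.dist w u : ℝ) ≤ D * G.dist w y + D - D * k * G.dist w y := by
  induction hn : G.dist w y generalizing y with
  | zero =>
    obtain rfl := hc.dist_eq_zero_iff.1 hn
    rw [Finset.sum_congr rfl (g := fun _ => (1 : ℝ))]
    · simp [hreg w]
    · intro u hu
      rw [dist_eq_one_iff_adj.2 ((mem_neighborFinset _ _ _).1 hu), Nat.cast_one]
  | succ n ih =>
    obtain ⟨x, hx, hd⟩ := hc.exists_adj_dist_add_one (x := y) (y := w) (by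
      rintro rfl; simp at hn)
    rw [dist_comm, dist_comm (u := x)] at hd
    have h1 := sum_dist_le_of_le_ollivierCurvature hc hreg hD hx.symm (hk x y hx.symm) hd
    have h2 := ih x (by omega)
    push_cast
    linarith

/-- The discrete Bonnet-Myers theorem. -/
theorem mul_dist_le_two (hc : G.Connected) (hreg : G.IsRegularOfDegree D)
    (hD : 0 < D) {k : ℝ} (hk : ∀ x y, G.Adj x y → k ≤ G.ollivierCurvature D x y) (w y : V) :
    k * G.dist w y ≤ 2 := by
  have h1 := sum_dist_le hc hreg hD hk w y
  have h2 : (D : ℝ) * (G.dist w y - 1) ≤ ∑ u ∈ G.neighborFinset y, (G.dist w u : ℝ) := by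
    rw [← hreg y, ← card_neighborFinset_eq_degree, ← nsmul_eq_mul]
    refine Finset.card_nsmul_le_sum _ _ _ fun u hu => ?_
    have := hc.dist_le_dist_add_one ((mem_neighborFinset _ _ _).1 hu).symm w
    have : (G.dist w y : ℝ) ≤ G.dist w u + 1 := by exact_mod_cast this
    linarith
  have hD' : (0 : ℝ) < D := by positivity
  refine le_of_mul_le_mul_left ?_ hD'
  linarith

/-- Poles at distance `2 / k` span the whole graph. -/
theorem rigidity_of_poles (hc : G.Connected) (hreg : G.IsRegularOfDegree D)
    (hD : 0 < D) {k : ℝ} (hk : ∀ x y, G.Adj x y → k ≤ G.ollivierCurvature D x y) {x y : V}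
    (hxy : k * G.dist x y = 2) :
    G.geodInterval x y = Set.univ ∧ ∀ z, ∑ u ∈ G.neighborFinset z, (G.dist x u : ℝ) =
      D * G.dist x z + D - D * k * G.dist x z := by
  have htri : ∀ u, (G.dist x y : ℝ) ≤ G.dist x u + G.dist y u := by
    intro u
    have := hc.dist_triangle (u := x) (v := u) (w := y)
    rw [dist_comm (u := u)] at this
    exact_mod_cast this
  -- The comparison bounds from both poles add up to `D * d(x, y)` because `k * d(x, y) = 2`. The
  -- triangle inequality at each neighbour gives the reverse bound, so equality holds throughout and
  -- passes to the neighbours of `z`.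
  have hstep : ∀ z, G.dist x z + G.dist y z = G.dist x y →
      (∀ u, G.Adj z u → G.dist x u + G.dist y u = G.dist x y) ∧
      ∑ u ∈ G.neighborFinset z, (G.dist x u : ℝ) =
        D * G.dist x z + D - D * k * G.dist x z := by
    intro z hz
    have hz' : (G.dist x z : ℝ) + G.dist y z = G.dist x y := by exact_mod_cast hz
    have h1 := sum_dist_le hc hreg hD hk x z
    have h2 := sum_dist_le hc hreg hD hk y z
    have h3 : ∑ u ∈ G.neighborFinset z, ((G.dist x u : ℝ) + G.dist y u - G.dist x y) =
        ∑ u ∈ G.neighborFinset z, (G.dist x u : ℝ) + ∑ u ∈ G.neighborFinset z, (G.dist y u : ℝ)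
          - D * G.dist x y := by
      rw [Finset.sum_sub_distrib, Finset.sum_add_distrib]
      simp [hreg z]
    have hnn : ∀ u ∈ G.neighborFinset z, 0 ≤ (G.dist x u : ℝ) + G.dist y u - G.dist x y :=
      fun u _ => sub_nonneg.2 (htri u)
    have h5 : (D : ℝ) * k * G.dist x z + D * k * G.dist y z = 2 * D := by
      rw [← mul_add, hz', mul_assoc, hxy, mul_comm]
    have h6 : (D : ℝ) * G.dist x z + D * G.dist y z = D * G.dist x y := by rw [← mul_add, hz']
    have h4 : ∑ u ∈ G.neighborFinset z, ((G.dist x u : ℝ) + G.dist y u - G.dist x y) = 0 :=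
      le_antisymm (by rw [h3]; linarith) (Finset.sum_nonneg hnn)
    constructor
    · intro u hu
      have := (Finset.sum_eq_zero_iff_of_nonneg hnn).1 h4 u ((mem_neighborFinset _ _ _).2 hu)
      have : (G.dist x u : ℝ) + G.dist y u = G.dist x y := by linarith
      exact_mod_cast this
    · rw [h4] at h3
      linarith
  have hall : ∀ z, G.dist x z + G.dist y z = G.dist x y := by
    intro z
    obtain ⟨p⟩ := hc.preconnected z x
    induction p with
    | nil => simp [dist_comm]
    | cons h p ih =>
      exact (hstep _ (ih hxy htri hstep)).1 _ h.symm
  refine ⟨?_, fun z => (hstep z (hall z)).2⟩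
  ext z
  rw [mem_geodInterval, dist_comm (u := z)]
  simp [hall z]

/-! ### Matchings versus optimal transport plans. -/

theorem sum_ite_eq_coe_privateNeighbors (x y u : V) (p : ℝ) :
    (∑ a : G.privateNeighbors x y, if u = (a : V) then p else 0) =
      if G.Adj x u ∧ ¬ G.Adj y u ∧ u ≠ y then p else 0 := by
  split_ifs with h
  · rw [Finset.sum_eq_single_of_mem (⟨u, mem_privateNeighbors.2 h⟩ : G.privateNeighbors x y) (Finset.mem_univ _)]
    · simp
    · exact fun b _ hb => if_neg fun hu => hb (Subtype.ext hu.symm)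
  · exact Finset.sum_eq_zero fun a _ => if_neg fun hu : u = a =>
      h (mem_privateNeighbors.1 (hu ▸ a.2))

/-- The ball around an end of an edge consists of the vertices shared with the ball around the
other end and the private neighbours. -/
theorem ite_mem_ball_eq {x y : V} (h : G.Adj x y) (u : V) (p : ℝ) :
    (if u ∈ insert x (G.neighborFinset x) then p else 0) =
      (if u ∈ insert x (G.neighborFinset x) ∩ insert y (G.neighborFinset y) then p else 0) +
        ∑ a : G.privateNeighbors x y, if u = (a : V) then p else 0 := by
  rw [sum_ite_eq_coe_privateNeighbors]
  simp only [Finset.mem_inter, Finset.mem_insert, mem_neighborFinset]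
  by_cases h1 : u = x
  · subst h1; simp [h.symm]
  · by_cases h2 : u = y <;> by_cases h3 : G.Adj x u <;> by_cases h4 : G.Adj y u <;>
      simp [h1, h2, h3, h4]

/-- A perfect matching between private neighbours bounds the curvature from below. -/
theorem SatisfiesLambdaAt.le_ollivierCurvature (hreg : G.IsRegularOfDegree D) (hD : 0 < D)
    {m : ℝ} {x y : V} (h : G.Adj x y) (hm : G.SatisfiesLambdaAt m x y) :
    (m + 2) / D ≤ G.ollivierCurvature D x y := by
  obtain ⟨hm, φ, hφ⟩ := hm
  have hD' : (0 : ℝ) < D := by positivity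
  rw [le_ollivierCurvature_iff hD h, mul_div_cancel₀ _ hD'.ne']
  set p : ℝ := 1 / ((D : ℝ) + 1) with hp
  have hp0 : 0 < p := by positivity
  have hp1 : p ≤ 1 := by rw [hp, div_le_one (by positivity)]; linarith
  let C : Finset V := insert x (G.neighborFinset x) ∩ insert y (G.neighborFinset y)
  -- Mass on the common part `C` of the two balls stays put; the rest moves one step along the
  -- matching.
  let π : V → V → ℝ := fun u v => (if u = v ∧ u ∈ C then p else 0) +
    ∑ a : G.privateNeighbors x y, if u = a ∧ v = φ a then p else 0
  have hrow : ∀ u, G.lazyMeasure p x u = ∑ v, π u v := by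
    intro u
    rw [lazyMeasure_eq hreg hD, ite_mem_ball_eq h, Finset.sum_add_distrib, Finset.sum_comm]
    simp only [ite_and, Finset.sum_ite_eq, Finset.mem_univ, if_true]
    congr 1
    refine Finset.sum_congr rfl fun a _ => ?_
    split_ifs <;> simp [hp]
  have hcol : ∀ v, G.lazyMeasure p y v = ∑ u, π u v := by
    intro v
    rw [lazyMeasure_eq hreg hD, ite_mem_ball_eq h.symm, Finset.inter_comm, Finset.sum_add_distrib, Finset.sum_comm, ← Equiv.sum_comp φ]
    simp only [ite_and, Finset.sum_ite_eq', Finset.mem_univ, if_true]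
    rfl
  have hnn : ∀ u v, 0 ≤ π u v := by
    intro u v
    refine add_nonneg (by split_ifs <;> positivity) (Finset.sum_nonneg fun a _ => ?_)
    split_ifs <;> positivity
  have hle : ∀ u v, π u v ≤ 1 := by
    intro u v
    calc π u v ≤ ∑ v, π u v := Finset.single_le_sum (fun v _ => hnn u v) (Finset.mem_univ v)
      _ = G.lazyMeasure p x u := (hrow u).symm
      _ ≤ 1 := by rw [lazyMeasure_eq hreg hD]; split_ifs <;> linarith
  have hπ : π ∈ transportPlans (G.lazyMeasure p x) (G.lazyMeasure p y) :=
    ⟨fun u v => ⟨hnn u v, hle u v⟩, hrow, hcol⟩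
  have hcost : G.transportCost π = Fintype.card (G.privateNeighbors x y) * p := by
    simp only [transportCost, π, mul_add, Finset.sum_add_distrib, Finset.mul_sum]
    rw [Finset.sum_eq_zero (fun u _ => Finset.sum_eq_zero fun v _ => ?_), zero_add]
    · rw [Finset.sum_congr rfl fun u _ => Finset.sum_comm, Finset.sum_comm,
        Finset.sum_congr rfl (g := fun _ => p) fun a _ => ?_]
      · simp
      · simp [ite_and, dist_eq_one_iff_adj.2 (hφ a)]
    · rw [ite_and]
      split_ifs with huv <;> simp [huv]
  have h1 := wassersteinDist_le (G := G) hπ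
  have h2 := card_privateNeighbors hreg h
  have h3 : ((D : ℝ) + 1) * p = 1 := by rw [hp]; field_simp
  calc ((D : ℝ) + 1) * G.wassersteinDist (G.lazyMeasure p x) (G.lazyMeasure p y)
      ≤ (D + 1) * (Fintype.card (G.privateNeighbors x y) * p) := by
        rw [← hcost]; gcongr
    _ = Fintype.card (G.privateNeighbors x y) := by rw [mul_left_comm, h3, mul_one]
    _ ≤ _ := by linarith

/-- Hall's condition holds for nonnegative matrices with constant row sums and smaller column
sums. -/
theorem exists_injective_of_sum_eq {α β : Type*} [Fintype α] [Fintype β]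
    (π : α → β → ℝ) (hπ : ∀ a b, 0 ≤ π a b) {p : ℝ} (hp : 0 < p) (hrow : ∀ a, ∑ b, π a b = p)
    (hcol : ∀ b, ∑ a, π a b ≤ p) :
    ∃ f : α → β, Function.Injective f ∧ ∀ a, π a (f a) ≠ 0 := by
  classical
  refine (Fintype.all_card_le_filter_rel_iff_exists_injective fun a b => π a b ≠ 0).1 fun A => ?_
  set B : Finset β := {b | ∃ a ∈ A, π a b ≠ 0} with hB
  have h1 : ∀ a ∈ A, ∑ b ∈ B, π a b = p := by
    intro a ha
    rw [← hrow a]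
    refine Finset.sum_subset (Finset.subset_univ _) fun b _ hb => ?_
    by_contra h
    exact hb (by simpa [hB] using ⟨a, ha, h⟩)
  have h2 : ∀ b ∈ B, ∑ a ∈ A, π a b ≤ p := fun b _ =>
    (Finset.sum_le_univ_sum_of_nonneg fun a => hπ a b).trans (hcol b)
  -- The mass leaving `A` all lands in `B`, where each column holds at most `p`.
  have h3 : (A.card : ℝ) * p ≤ B.card * p := by
    calc (A.card : ℝ) * p = ∑ a ∈ A, ∑ b ∈ B, π a b := by
          rw [Finset.sum_congr rfl h1, Finset.sum_const, nsmul_eq_mul]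
      _ = ∑ b ∈ B, ∑ a ∈ A, π a b := Finset.sum_comm
      _ ≤ ∑ _b ∈ B, p := Finset.sum_le_sum h2
      _ = B.card * p := by rw [Finset.sum_const, nsmul_eq_mul]
  exact_mod_cast le_of_mul_le_mul_right h3 hp

/-- If the curvature of an edge is attained by the distance function from one of its ends, then an
optimal transport plan yields a perfect matching between private neighbours. -/
theorem satisfiesLambdaAt_of_le_ollivierCurvature (hc : G.Connected)
    (hreg : G.IsRegularOfDegree D) (hD : 0 < D) {c : ℝ} (hE : G.DistLaplacianEq D c) {x y : V}
    (h : G.Adj x y) (hk : c / D ≤ G.ollivierCurvature D x y) :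
    G.SatisfiesLambdaAt (c - 2) x y := by
  have hD' : (0 : ℝ) < D := by positivity
  have hDc : (D : ℝ) * (c / D) = c := mul_div_cancel₀ _ hD'.ne'
  have hdxy := dist_eq_one_iff_adj.2 h
  have hcard := card_privateNeighbors hreg h
  have hcard' := card_privateNeighbors hreg h.symm
  rw [commonNeighbors_symm] at hcard'
  refine ⟨?_, ?_⟩
  -- The neighbours of `y` lie at distance 0, 1 or 2 from `x`, so the Laplacian identity at `y`
  -- counts the triangles: there are exactly `c - 2`.
  · have e1 := sum_neighborFinset_eq h.symm (fun u => (G.dist x u : ℝ))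
    rw [hE, hdxy, dist_self] at e1
    have e2 : ∑ u ∈ G.neighborFinset y ∩ G.neighborFinset x, (G.dist x u : ℝ) =
        (G.commonNeighbors x y).ncard := by
      rw [commonNeighbors_symm, ncard_commonNeighbors, Finset.cast_card]
      refine Finset.sum_congr rfl fun u hu => ?_
      rw [dist_eq_one_iff_adj.2 ((mem_neighborFinset _ _ _).1 (Finset.mem_inter.1 hu).2),
        Nat.cast_one]
    have e3 : ∑ a : G.privateNeighbors y x, (G.dist x a : ℝ) =
        2 * Fintype.card (G.privateNeighbors y x) := by
      rw [Finset.sum_congr rfl (g := fun _ => (2 : ℝ)) fun a _ => ?_]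
      · simp [mul_comm]
      · rw [dist_comm, hc.dist_eq_two_of_mem_privateNeighbors h.symm a.2, Nat.cast_ofNat]
    rw [e2, e3] at e1
    push_cast at e1
    linarith
  rw [le_ollivierCurvature_iff hD h, hDc] at hk
  obtain ⟨π, hπ, hcost⟩ := exists_transportCost_eq_wassersteinDist (G := G)
    (transportPlans_lazyMeasure_nonempty hreg hD x y)
  have h1 := transportCost_sub_sum_mul_sub_sum_mul (G := G) hπ (fun u => (G.dist x u : ℝ))
  have hnn : ∀ u v, 0 ≤ ((G.dist u v : ℝ) - (G.dist x v - G.dist x u)) * π u v := by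
    intro u v
    refine mul_nonneg ?_ (hπ.1 u v).1
    have := hc.dist_triangle (u := x) (v := u) (w := v)
    have : (G.dist x v : ℝ) ≤ G.dist x u + G.dist u v := by exact_mod_cast this
    linarith
  -- The potential `d(x, ·)` has dual value `(D + 1 - c) / (D + 1)`, which is also the upper bound
  -- on `W₁` given by `hk`; the duality gap is zero.
  have hle : ∑ u, ∑ v, ((G.dist u v : ℝ) - (G.dist x v - G.dist x u)) * π u v ≤ 0 := by
    rw [← h1, hcost, sum_mul_lazyMeasure hreg hD, sum_mul_lazyMeasure hreg hD, ← sub_div,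
      sub_nonpos, le_div_iff₀ (by positivity), hE, hE, hdxy, dist_self]
    push_cast
    linarith
  have htight : ∀ u v, π u v ≠ 0 → G.dist x u + G.dist u v = G.dist x v := by
    intro u v huv
    have e1 := (Finset.sum_eq_zero_iff_of_nonneg
      fun u _ => Finset.sum_nonneg fun v _ => hnn u v).1
      (le_antisymm hle (Finset.sum_nonneg fun u _ => Finset.sum_nonneg fun v _ => hnn u v))
      u (Finset.mem_univ u)
    have e2 := (Finset.sum_eq_zero_iff_of_nonneg fun v _ => hnn u v).1 e1 v (Finset.mem_univ v)
    have e3 := (mul_eq_zero.1 e2).resolve_right huv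
    have : (G.dist x u : ℝ) + G.dist u v = G.dist x v := by linarith
    exact_mod_cast this
  have hball : ∀ u v, π u v ≠ 0 → v ∈ insert y (G.neighborFinset y) := by
    intro u v huv
    by_contra hv
    have e1 := hπ.2.2 v
    rw [lazyMeasure_eq hreg hD, if_neg hv] at e1
    exact huv ((Finset.sum_eq_zero_iff_of_nonneg fun u _ => (hπ.1 u v).1).1 e1.symm u
      (Finset.mem_univ u))
  -- Since `a` is outside the ball around `y`, its mass must move, and tightness gives `d(x, v) = 1
  -- + d(a, v) ≥ 2`. The ball around `y` reaches only distance 2 from `x`, so `d(a, v) = 1`.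
  have hsupp : ∀ (a : G.privateNeighbors x y) (v : V), π a v ≠ 0 →
      v ∈ G.privateNeighbors y x ∧ G.Adj (a : V) v := by
    intro a v hav
    obtain ⟨hxa, hya, hay⟩ := mem_privateNeighbors.1 a.2
    have e1 := htight a v hav
    have e2 := hball a v hav
    rw [dist_eq_one_iff_adj.2 hxa] at e1
    rw [Finset.mem_insert, mem_neighborFinset] at e2
    have e3 : (a : V) ≠ v := by
      rintro he
      rw [← he] at e2
      exact e2.elim hay hya
    have e4 := hc.pos_dist_of_ne e3
    have e5 : G.Adj y v := e2.resolve_left (by rintro rfl; omega)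
    have e6 := hc.dist_le_dist_add_one e5 x
    refine ⟨mem_privateNeighbors.2 ⟨e5, fun h => ?_, ?_⟩, dist_eq_one_iff_adj.1 (by omega)⟩
    · rw [dist_eq_one_iff_adj.2 h] at e1
      omega
    · rintro rfl
      rw [dist_self] at e1
      omega
  obtain ⟨f, hf, hfπ⟩ := exists_injective_of_sum_eq
    (fun (a : G.privateNeighbors x y) (b : G.privateNeighbors y x) => π a b)
    (fun a b => (hπ.1 a b).1) (p := 1 / ((D : ℝ) + 1)) (by positivity)
    (by
      intro a
      have e1 := hπ.2.1 (a : V)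
      rw [lazyMeasure_eq hreg hD,
        if_pos (by simp [(mem_privateNeighbors.1 a.2).1])] at e1
      rw [e1, ← Finset.sum_subset (Finset.subset_univ (G.privateNeighbors y x).toFinset)]
      · exact (Finset.sum_subtype _ (fun v => Set.mem_toFinset) _).symm
      · intro v _ hv
        by_contra h
        exact hv (Set.mem_toFinset.2 (hsupp a v h).1))
    (by
      intro b
      have e1 := hπ.2.2 (b : V)
      rw [lazyMeasure_eq hreg hD,
        if_pos (by simp [(mem_privateNeighbors.1 b.2).1])] at e1
      rw [e1, ← Finset.sum_subtype (G.privateNeighbors x y).toFinset (fun v => Set.mem_toFinset)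
        (fun u => π u b)]
      exact Finset.sum_le_univ_sum_of_nonneg fun u => (hπ.1 u b).1)
  have hcards : Fintype.card (G.privateNeighbors x y) = Fintype.card (G.privateNeighbors y x) := by
    have : (Fintype.card (G.privateNeighbors x y) : ℝ) =
      Fintype.card (G.privateNeighbors y x) := by linarith
    exact_mod_cast this
  exact ⟨Equiv.ofBijective f ((Fintype.bijective_iff_injective_and_card f).2 ⟨hf, hcards⟩),
    fun a => (hsupp a _ (hfπ a)).2⟩

end Measure

end SimpleGraph

/-! ### Assembly of the three statements. -/

theorem mainTheorem2 {V : Type*} [Fintype V] [DecidableEq V] [Nontrivial V]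
    (G : SimpleGraph V) [DecidableRel G.Adj] (D : ℕ)
    (hconn : G.Connected) (hreg : G.IsRegularOfDegree D) (hself : G.IsSelfCentered) :
    (G.IsBonnetMyersSharp D →
      (∀ x y : V, x ≠ y → (G.induce (G.geodInterval x y)).IsAntipodal) ∧
        G.IsStronglySpherical) ∧
    (G.SatisfiesLambda (2 * (D : ℝ) / (G.diam : ℝ) - 2) → G.IsStronglySpherical) ∧
    (G.IsBonnetMyersSharp D ↔ G.SatisfiesLambda (2 * (D : ℝ) / (G.diam : ℝ) - 2)) := by
  have hL : 0 < (G.diam : ℝ) :=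
    Nat.cast_pos.2 (Nat.pos_of_ne_zero (SimpleGraph.connected_iff_diam_ne_zero.1 hconn))
  have hD : 0 < D := by
    obtain ⟨x⟩ := hconn.nonempty
    rw [← hreg x]
    exact hconn.preconnected.degree_pos_of_nontrivial x
  have hD' : (0 : ℝ) < D := by positivity
  have hcD : 2 * (D : ℝ) / G.diam / D = 2 / G.diam := by field_simp
  have hcD' : (D : ℝ) * (2 / G.diam) = 2 * D / G.diam := by ring
  have hlow : G.IsBonnetMyersSharp D → ∀ x y, G.Adj x y →
      2 / (G.diam : ℝ) ≤ G.ollivierCurvature D x y :=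
    fun hBM x y h => hBM.isGLB.1 ⟨x, y, h, rfl⟩
  have hrig : G.IsBonnetMyersSharp D →
      G.IsAntipodal ∧ G.DistLaplacianEq D (2 * (D : ℝ) / G.diam) := by
    intro hBM
    have key : ∀ x y, G.dist x y = G.diam → 2 / (G.diam : ℝ) * G.dist x y = 2 := fun x y hxy => by
      rw [hxy, div_mul_cancel₀ _ hL.ne']
    refine ⟨⟨hconn, fun x => ?_⟩, fun x z => ?_⟩
    · obtain ⟨y, hy⟩ := hself x
      refine ⟨y, ?_, (SimpleGraph.rigidity_of_poles hconn hreg hD (hlow hBM) (key x y hy)).1⟩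
      rintro rfl
      rw [← hy, SimpleGraph.dist_self, Nat.cast_zero] at hL
      exact lt_irrefl _ hL
    -- The base point of the identity must be a pole; self-centeredness provides this for every `x`.
    · obtain ⟨y, hy⟩ := hself x
      rw [← hcD']
      exact (SimpleGraph.rigidity_of_poles hconn hreg hD (hlow hBM) (key x y hy)).2 z
  have hBL : G.IsBonnetMyersSharp D → G.SatisfiesLambda (2 * (D : ℝ) / (G.diam : ℝ) - 2) :=
    fun hBM x y h => SimpleGraph.satisfiesLambdaAt_of_le_ollivierCurvature hconn hreg hD
      (hrig hBM).2 h (hcD.trans_le (hlow hBM x y h))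
  have hLB : G.SatisfiesLambda (2 * (D : ℝ) / (G.diam : ℝ) - 2) → G.IsBonnetMyersSharp D := by
    refine fun hΛ => ⟨hconn, hreg, by positivity, ?_, fun k hk => ?_⟩
    · rintro _ ⟨x, y, h, rfl⟩
      have := (hΛ x y h).le_ollivierCurvature hreg hD h
      rwa [sub_add_cancel, hcD] at this
    -- Any lower curvature bound `k` satisfies `k * L ≤ 2` by Bonnet-Myers on a pair of poles, so `2
    -- / L` is the greatest one.
    · obtain ⟨x⟩ := hconn.nonempty
      obtain ⟨y, hy⟩ := hself x
      have := SimpleGraph.mul_dist_le_two hconn hreg hD (fun x y h => hk ⟨x, y, h, rfl⟩) x y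
      rw [hy] at this
      rwa [le_div_iff₀ hL]
  have hBS : G.IsBonnetMyersSharp D → G.IsStronglySpherical := fun hBM =>
    SimpleGraph.isStronglySpherical_of_satisfiesLambda (hrig hBM).1 hreg (hrig hBM).2 (hBL hBM)
  exact ⟨fun hBM => ⟨fun x y hxy => (hBS hBM).isAntipodal_induce hxy, hBS hBM⟩,
    fun hΛ => hBS (hLB hΛ), hBL, hLB⟩
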